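/- Let $K$ be a field (for instance $\mathbb{C}$) and let $\alpha,\beta,q\in K$ satisfy $q^k\neq 1$ for all $k\ge 1$ and $\alpha\beta q^k\neq 1$ for all $k\ge 0$. Write $(a;q)_n=\prod_{i=0}^{n-1}(1-aq^i)$ for $n\geq 0$. Let $Q_n(x)=Q_n(x;\alpha,\beta|q)\in K[x]$ be the Al-Salam–Chihara polynomials, defined by $Q_{-1}(x)=0$, $Q_0(x)=1$ and $$Q_{n+1}(x)=\bigl(2x-(\alpha+\beta)q^n\bigr)Q_n(x)-(1-q^n)(1-\alpha\beta q^{n-1})Q_{n-1}(x)\qquad(n\ge 0).$$ (For $n=0$ the last term is $0$.) Then for all integers $n_1,n_2\ge 0$, $$Q_{n_1}(x)Q_{n_2}(x)=\sum_{n_3\ge 0}C_{n_1,n_2}^{n_3}(\alpha,\beta;q)\,Q_{n_3}(x)$$ in $K[x]$, where $$C_{n_1,n_2}^{n_3}(\alpha,\beta;q)=(-1)^{n_1+n_2+n_3}\frac{(q;q)_{n_1}(q;q)_{n_2}}{(\alpha\beta;q)_{n_3}}\sum_{m_2,m_3}\frac{(\alpha\beta;q)_{n_1+m_3}\,\alpha^{m_2}\beta^{M}q^{\binom{m_2}{2}+\binom{M}{2}}}{(q;q)_{M}\,(q;q)_{m_2}\,(q;q)_{m_3+n_1-n_3}\,(q;q)_{m_3+n_1-n_2}\,(q;q)_{m_3}},$$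 with $M=n_3+n_2-n_1-m_2-2m_3$, the sum being over all integers $m_2,m_3\ge 0$ for which $M$, $m_3+n_1-n_3$ and $m_3+n_1-n_2$ are nonnegative (here $0^0=1$). Moreover $C_{n_1,n_2}^{n_3}(\alpha,\beta;q)=0$ for $n_3>n_1+n_2$, so the sum over $n_3$ is finite. -/

import Mathlib

/-- The finite `q`-Pochhammer symbol `(a; q)_n = (1 - a) (1 - a q) ⋯ (1 - a q ^ (n - 1))`. -/
def qPoch {K : Type*} [CommRing K] (a q : K) (n : ℕ) : K :=
  ∏ i ∈ Finset.range n, (1 - a * q ^ i)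

/-- The Al-Salam–Chihara polynomials `Q_n(x; α, β | q)`, through
`Q_{n+1} = (2x - (α + β) q^n) Q_n - (1 - q^n) (1 - α β q^(n-1)) Q_{n-1}`, `Q_0 = 1`, `Q_{-1} = 0`.
-/
noncomputable def alSalamChihara {K : Type*} [CommRing K] (α β q : K) : ℕ → Polynomial K
  | 0 => 1
  | 1 => 2 * Polynomial.X - Polynomial.C (α + β)
  | n + 2 =>
      (2 * Polynomial.X - Polynomial.C ((α + β) * q ^ (n + 1))) * alSalamChihara α β q (n + 1)
        - Polynomial.C ((1 - q ^ (n + 1)) * (1 - α * β * q ^ n)) * alSalamChihara α β q n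

/-- The pairs `(m₂, m₃)` of natural numbers for which the subscripts
`n₃ + n₂ - n₁ - m₂ - 2 m₃`, `m₃ + n₁ - n₃` and `m₃ + n₁ - n₂` are all nonnegative.
The first condition forces `m₂, m₃ ≤ n₂ + n₃`, so the bounding box discards nothing. -/
def linIndex (n₁ n₂ n₃ : ℕ) : Finset (ℕ × ℕ) :=
  (Finset.range (n₂ + n₃ + 1) ×ˢ Finset.range (n₂ + n₃ + 1)).filter fun m =>
    n₁ + m.1 + 2 * m.2 ≤ n₃ + n₂ ∧ n₃ ≤ m.2 + n₁ ∧ n₂ ≤ m.2 + n₁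

theorem mem_linIndex {n₁ n₂ n₃ m₂ m₃ : ℕ} :
    (m₂, m₃) ∈ linIndex n₁ n₂ n₃ ↔
      n₁ + m₂ + 2 * m₃ ≤ n₃ + n₂ ∧ n₃ ≤ m₃ + n₁ ∧ n₂ ≤ m₃ + n₁ := by
  simp only [linIndex, Finset.mem_filter, Finset.mem_product, Finset.mem_range]
  omega

/-- The coefficient `C_{n₁,n₂}^{n₃}(α, β; q)`, with the convention `1 / (q; q)_k = 0` for `k < 0`.
On `linIndex` none of the natural-number subtractions truncates. -/
noncomputable def linCoeff {K : Type*} [Field K] (α β q : K) (n₁ n₂ n₃ : ℕ) : K :=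
  (-1) ^ (n₁ + n₂ + n₃) * (qPoch q q n₁ * qPoch q q n₂ / qPoch (α * β) q n₃) *
    ∑ m ∈ linIndex n₁ n₂ n₃,
      qPoch (α * β) q (n₁ + m.2) * α ^ m.1 * β ^ (n₃ + n₂ - n₁ - m.1 - 2 * m.2) *
          q ^ (m.1.choose 2 + (n₃ + n₂ - n₁ - m.1 - 2 * m.2).choose 2) /
        (qPoch q q (n₃ + n₂ - n₁ - m.1 - 2 * m.2) * qPoch q q m.1 *
          qPoch q q (m.2 + n₁ - n₃) * qPoch q q (m.2 + n₁ - n₂) * qPoch q q m.2)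

section Auxiliary

variable {K : Type*} [Field K]

/-! Put $N=n_1+m_3$ and let $e_r$ be the coefficient of $t^r$ in $(-\alpha t;q)_\infty(-\beta
t;q)_\infty$. Up to a prefactor, $C_{n_1,n_2}^{n_3}$ is the symmetric sum over $N$ of
$(\alpha\beta;q)_N\,e_{n_1+n_2+n_3-2N}/\prod_i(q;q)_{N-n_i}$ (`linCoeff_eq_linSum`). Comparing
$2x\,Q_{n_1}$ with $2x\,Q_{n_3}$ inside the expansion, the theorem amounts to a contiguity relation
between shifts of $n_1$ and of $n_3$, plus the case $n_1=0$. In that relation the recurrence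
`qExpMulCoeff_rec` trades $e_r$ for $e_{r\pm1}$, and the resulting sum telescopes in $N$
(`linTerm_telescope`, `linSum_contiguous`). Induction on $n_1$ finishes. -/

theorem qPoch_succ (a q : K) (n : ℕ) : qPoch a q (n + 1) = qPoch a q n * (1 - a * q ^ n) :=
  Finset.prod_range_succ _ _

theorem qPoch_ne_zero {a q : K} (h : ∀ k : ℕ, a * q ^ k ≠ 1) (n : ℕ) : qPoch a q n ≠ 0 :=
  Finset.prod_ne_zero_iff.2 fun i _ => sub_ne_zero.2 (h i).symm

theorem qPoch_self_ne_zero {q : K} (hq : ∀ k : ℕ, 1 ≤ k → q ^ k ≠ 1) (n : ℕ) :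
    qPoch q q n ≠ 0 :=
  qPoch_ne_zero (fun k => by rw [← pow_succ']; exact hq _ k.succ_pos) n

/-! ### Generating function of the numerators -/

/-- The power series `∑ a ^ m q ^ (m choose 2) / (q; q)_m t ^ m`, that is `(-a t; q)_∞`. -/
noncomputable def qExp (a q : K) : PowerSeries K :=
  PowerSeries.mk fun m => a ^ m * q ^ m.choose 2 / qPoch q q m

theorem qExp_eq_mul_rescale {q : K} (hq : ∀ k : ℕ, 1 ≤ k → q ^ k ≠ 1) (a : K) :
    qExp a q = (1 + PowerSeries.C a * PowerSeries.X) * PowerSeries.rescale q (qExp a q) := by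
  ext n
  rw [add_mul, one_mul, mul_assoc, map_add, PowerSeries.coeff_C_mul, PowerSeries.coeff_rescale]
  cases n with
  | zero => simp
  | succ n =>
    rw [PowerSeries.coeff_succ_X_mul, PowerSeries.coeff_rescale]
    simp only [qExp, PowerSeries.coeff_mk]
    have h1 := qPoch_self_ne_zero hq n
    have h2 : 1 - q * q ^ n ≠ 0 := by
      rw [← pow_succ']
      exact sub_ne_zero.2 (hq _ n.succ_pos).symm
    rw [qPoch_succ, Nat.choose_succ_succ' n 1, Nat.choose_one_right]
    field_simp
    ring

/-- The coefficients of `(-a t; q)_∞ (-b t; q)_∞`, extended by zero to negative indices. -/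
noncomputable def qExpMulCoeff (a b q : K) (r : ℤ) : K :=
  if 0 ≤ r then PowerSeries.coeff r.toNat (qExp a q * qExp b q) else 0

theorem qExpMulCoeff_of_neg (a b q : K) {r : ℤ} (hr : r < 0) : qExpMulCoeff a b q r = 0 :=
  if_neg (not_le.2 hr)

theorem qExpMulCoeff_natCast (a b q : K) (r : ℕ) :
    qExpMulCoeff a b q r = ∑ m ∈ Finset.HasAntidiagonal.antidiagonal r,
      (a ^ m.1 * q ^ m.1.choose 2 / qPoch q q m.1) *
        (b ^ m.2 * q ^ m.2.choose 2 / qPoch q q m.2) := by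
  simp [qExpMulCoeff, PowerSeries.coeff_mul, qExp]

theorem qExp_mul_qExp {q : K} (hq : ∀ k : ℕ, 1 ≤ k → q ^ k ≠ 1) (a b : K) :
    qExp a q * qExp b q = PowerSeries.rescale q (qExp a q * qExp b q) +
      PowerSeries.C (a + b) * (PowerSeries.X * PowerSeries.rescale q (qExp a q * qExp b q)) +
      PowerSeries.C (a * b) *
        (PowerSeries.X * (PowerSeries.X * PowerSeries.rescale q (qExp a q * qExp b q))) := by
  conv_lhs => rw [qExp_eq_mul_rescale hq a, qExp_eq_mul_rescale hq b]
  rw [map_mul, map_add, map_mul]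
  ring

/-- Compare coefficients of $t^{r+1}$ in $F(t)=(1+at)(1+bt)F(qt)$. Wherever `toNat` truncates, the
accompanying coefficient is zero. -/
theorem qExpMulCoeff_rec {q : K} (hq : ∀ k : ℕ, 1 ≤ k → q ^ k ≠ 1) (a b : K) (r : ℤ) :
    (a + b) * q ^ r.toNat * qExpMulCoeff a b q r =
      (1 - q ^ (r + 1).toNat) * qExpMulCoeff a b q (r + 1) -
        a * b * q ^ (r - 1).toNat * qExpMulCoeff a b q (r - 1) := by
  have key := fun n => congrArg (PowerSeries.coeff n) (qExp_mul_qExp hq a b)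
  rcases lt_trichotomy r (-1) with h | rfl | h
  · simp [qExpMulCoeff_of_neg, show r < 0 by omega, show r + 1 < 0 by omega,
      show r - 1 < 0 by omega]
  · simp [qExpMulCoeff]
  · obtain ⟨n, rfl⟩ := Int.eq_ofNat_of_zero_le (show 0 ≤ r by omega)
    have k := key (n + 1)
    rw [map_add, map_add, PowerSeries.coeff_C_mul, PowerSeries.coeff_C_mul,
      PowerSeries.coeff_succ_X_mul, PowerSeries.coeff_succ_X_mul, PowerSeries.coeff_rescale,
      PowerSeries.coeff_rescale] at k
    have e1 : ((n : ℤ) + 1).toNat = n + 1 := by omega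
    cases n with
    | zero =>
      simp only [PowerSeries.coeff_zero_X_mul] at k
      simp [qExpMulCoeff] at k ⊢
      linear_combination -k
    | succ m =>
      rw [PowerSeries.coeff_succ_X_mul, PowerSeries.coeff_rescale] at k
      have e2 : (((m + 1 : ℕ) : ℤ) - 1).toNat = m := by omega
      simp only [qExpMulCoeff, e1, e2, Int.toNat_natCast]
      rw [if_pos (by omega), if_pos (by omega), if_pos (by omega)]
      linear_combination -k

/-! ### Symmetric summand and its telescoping -/

/-- `1 / (q; q)_n`, extended by zero to negative `n`. -/
noncomputable def qPochInv (q : K) (n : ℤ) : K :=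
  if 0 ≤ n then (qPoch q q n.toNat)⁻¹ else 0

theorem qPochInv_of_neg (q : K) {n : ℤ} (hn : n < 0) : qPochInv q n = 0 :=
  if_neg (not_le.2 hn)

theorem qPochInv_natCast (q : K) (n : ℕ) : qPochInv q n = (qPoch q q n)⁻¹ := by
  simp [qPochInv]

theorem qPochInv_sub_one {q : K} (hq : ∀ k : ℕ, 1 ≤ k → q ^ k ≠ 1) (n : ℤ) :
    qPochInv q (n - 1) = (1 - q ^ n.toNat) * qPochInv q n := by
  rcases lt_trichotomy n 0 with h | rfl | h
  · simp [qPochInv_of_neg, h, show n - 1 < 0 by omega]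
  · simp [qPochInv]
  · obtain ⟨m, rfl⟩ : ∃ m : ℕ, n = (m + 1 : ℕ) := ⟨n.toNat - 1, by omega⟩
    rw [show ((m + 1 : ℕ) : ℤ) - 1 = (m : ℕ) by omega, qPochInv_natCast, qPochInv_natCast,
      Int.toNat_natCast, qPoch_succ]
    have h1 := qPoch_self_ne_zero hq m
    have h2 : 1 - q * q ^ m ≠ 0 := by
      rw [← pow_succ']
      exact sub_ne_zero.2 (hq _ m.succ_pos).symm
    rw [pow_succ']
    field_simp

/-- The summand of the symmetric form of the linearization coefficients. -/
noncomputable def linTerm (α β q : K) (N n₁ n₂ n₃ : ℤ) : K :=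
  qPoch (α * β) q N.toNat * qExpMulCoeff α β q (n₁ + n₂ + n₃ - 2 * N) *
    (qPochInv q (N - n₁) * qPochInv q (N - n₂) * qPochInv q (N - n₃))

theorem linTerm_eq_zero (α β q : K) {N n₁ n₂ n₃ : ℤ}
    (h : N < n₁ ∨ N < n₂ ∨ N < n₃ ∨ n₁ + n₂ + n₃ < 2 * N) : linTerm α β q N n₁ n₂ n₃ = 0 := by
  rcases h with h | h | h | h
  · simp [linTerm, qPochInv_of_neg q (sub_neg.2 h)]
  · simp [linTerm, qPochInv_of_neg q (sub_neg.2 h)]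
  · simp [linTerm, qPochInv_of_neg q (sub_neg.2 h)]
  · simp [linTerm, qExpMulCoeff_of_neg α β q (sub_neg.2 h)]

theorem pow_toNat_mul_one_sub (q : K) (s v w : ℕ) :
    (1 - q ^ v) * (1 - q ^ w) * q ^ ((s : ℤ) - 2 + v + w).toNat =
      (1 - q ^ v) * (1 - q ^ w) *
        (q ^ s * q ^ ((v : ℤ) - 1).toNat * q ^ ((w : ℤ) - 1).toNat) := by
  rcases v with _ | v
  · simp
  rcases w with _ | w
  · simp
  rw [show ((s : ℤ) - 2 + (v + 1 : ℕ) + (w + 1 : ℕ)).toNat = s + v + w by omega,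
    show (((v + 1 : ℕ) : ℤ) - 1).toNat = v by omega,
    show (((w + 1 : ℕ) : ℤ) - 1).toNat = w by omega]
  ring

/-- With $N=s-1+u+v+w$ this is $(A;q)_N=(A;q)_{N-1}(1-Aq^{N-1})$, with $q^{N-1}$ split so that each
truncated exponent meets a vanishing factor. -/
theorem qPoch_toNat_mul_one_sub (A q : K) (s u v w : ℕ) :
    qPoch A q ((s : ℤ) - 1 + u + v + w).toNat * ((q ^ w - q ^ u) * (1 - q ^ v)) =
      qPoch A q ((s : ℤ) - 1 + u + v + w - 1).toNat * ((q ^ w - q ^ u) * (1 - q ^ v) -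
        A * q ^ s * q ^ ((v : ℤ) - 1).toNat * (1 - q ^ v) *
          (q ^ ((u : ℤ) - 1).toNat * q ^ w * (1 - q ^ u) -
            q ^ u * q ^ ((w : ℤ) - 1).toNat * (1 - q ^ w))) := by
  rcases v with _ | v
  · simp
  rw [show (((v + 1 : ℕ) : ℤ) - 1).toNat = v by omega]
  rcases u with _ | u <;> rcases w with _ | w
  · simp
  · rw [show ((s : ℤ) - 1 + (0 : ℕ) + (v + 1 : ℕ) + (w + 1 : ℕ)).toNat = s + v + w + 1 by omega,
      show ((s : ℤ) - 1 + (0 : ℕ) + (v + 1 : ℕ) + (w + 1 : ℕ) - 1).toNat = s + v + w by omega,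
      show (((w + 1 : ℕ) : ℤ) - 1).toNat = w by omega, qPoch_succ]
    ring
  · rw [show ((s : ℤ) - 1 + (u + 1 : ℕ) + (v + 1 : ℕ) + (0 : ℕ)).toNat = s + u + v + 1 by omega,
      show ((s : ℤ) - 1 + (u + 1 : ℕ) + (v + 1 : ℕ) + (0 : ℕ) - 1).toNat = s + u + v by omega,
      show (((u + 1 : ℕ) : ℤ) - 1).toNat = u by omega, qPoch_succ]
    ring
  · rw [show ((s : ℤ) - 1 + (u + 1 : ℕ) + (v + 1 : ℕ) + (w + 1 : ℕ)).toNat =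
        s + u + v + w + 1 + 1 by omega,
      show ((s : ℤ) - 1 + (u + 1 : ℕ) + (v + 1 : ℕ) + (w + 1 : ℕ) - 1).toNat =
        s + u + v + w + 1 by omega,
      show (((u + 1 : ℕ) : ℤ) - 1).toNat = u by omega,
      show (((w + 1 : ℕ) : ℤ) - 1).toNat = w by omega, qPoch_succ A q (_ + 1)]
    ring

/-- The cancellation between `linRaise` at `N` and `linLower` at `N - 1`, with
`s = n₁ + n₂ + n₃ - 2 N + 1`, `u = N - n₁`, `v = N - n₂`, `w = N - n₃`. -/
theorem linTerm_telescope {q : K} (hq : ∀ k : ℕ, 1 ≤ k → q ^ k ≠ 1) (α β A : K)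
    (s u v w : ℤ) :
    qPoch A q (s - 1 + u + v + w).toNat * qExpMulCoeff α β q s *
      ((1 - q ^ (s + v + w).toNat) * (qPochInv q (u - 1) * qPochInv q v * qPochInv q w) -
        (1 - q ^ (s + v + u).toNat) * (qPochInv q u * qPochInv q v * qPochInv q (w - 1)) -
        q ^ v.toNat * (q ^ w.toNat - q ^ u.toNat) * (1 - q ^ s.toNat) *
          (qPochInv q u * qPochInv q v * qPochInv q w)) +
    qPoch A q (s - 1 + u + v + w - 1).toNat * qExpMulCoeff α β q s *
      ((1 - A * q ^ (s - 2 + v + w).toNat) *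
          (qPochInv q u * qPochInv q (v - 1) * qPochInv q (w - 1)) -
        (1 - A * q ^ (s - 2 + v + u).toNat) *
          (qPochInv q (u - 1) * qPochInv q (v - 1) * qPochInv q w) +
        q ^ (v - 1).toNat * (q ^ (w - 1).toNat - q ^ (u - 1).toNat) * (A * q ^ s.toNat) *
          (qPochInv q (u - 1) * qPochInv q (v - 1) * qPochInv q (w - 1))) = 0 := by
  -- Every shifted reciprocal becomes a multiple of the unshifted one, so a negative index kills the
  -- whole expression and all indices may be taken natural.
  simp only [qPochInv_sub_one hq]
  rcases lt_or_ge s 0 with hs | hs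
  · simp [qExpMulCoeff_of_neg α β q hs]
  rcases lt_or_ge u 0 with hu | hu
  · simp [qPochInv_of_neg q hu]
  rcases lt_or_ge v 0 with hv | hv
  · simp [qPochInv_of_neg q hv]
  rcases lt_or_ge w 0 with hw | hw
  · simp [qPochInv_of_neg q hw]
  lift s to ℕ using hs
  lift u to ℕ using hu
  lift v to ℕ using hv
  lift w to ℕ using hw
  have f1 := pow_toNat_mul_one_sub q s v w
  have f2 := pow_toNat_mul_one_sub q s v u
  have f3 := qPoch_toNat_mul_one_sub A q s u v w
  rw [show ((s : ℤ) + v + w).toNat = s + v + w by omega,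
    show ((s : ℤ) + v + u).toNat = s + v + u by omega, pow_add, pow_add, pow_add q (s + v) u,
    pow_add]
  simp only [Int.toNat_natCast]
  generalize qPoch A q ((s : ℤ) - 1 + u + v + w).toNat = G at *
  generalize qPoch A q ((s : ℤ) - 1 + u + v + w - 1).toNat = G' at *
  generalize q ^ ((s : ℤ) - 2 + v + w).toNat = x at *
  generalize q ^ ((s : ℤ) - 2 + v + u).toNat = y at *
  generalize q ^ ((u : ℤ) - 1).toNat = a at *
  generalize q ^ ((v : ℤ) - 1).toNat = b at *
  generalize q ^ ((w : ℤ) - 1).toNat = c at *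
  linear_combination (qExpMulCoeff α β q s * (qPochInv q u * qPochInv q v * qPochInv q w)) *
    (f3 - G' * A * f1 + G' * A * f2)

theorem qExpMulCoeff_mul_pow_sub {q : K} (α β : K) (r u v w : ℤ) :
    (q ^ (r + v + w).toNat - q ^ (r + v + u).toNat) * (qExpMulCoeff α β q r *
      (qPochInv q u * qPochInv q v * qPochInv q w)) =
    q ^ v.toNat * (q ^ w.toNat - q ^ u.toNat) * (q ^ r.toNat * qExpMulCoeff α β q r) *
      (qPochInv q u * qPochInv q v * qPochInv q w) := by
  rcases lt_or_ge r 0 with hr | hr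
  · simp [qExpMulCoeff_of_neg α β q hr]
  rcases lt_or_ge u 0 with hu | hu
  · simp [qPochInv_of_neg q hu]
  rcases lt_or_ge v 0 with hv | hv
  · simp [qPochInv_of_neg q hv]
  rcases lt_or_ge w 0 with hw | hw
  · simp [qPochInv_of_neg q hw]
  rw [show (r + v + w).toNat = r.toNat + v.toNat + w.toNat by omega,
    show (r + v + u).toNat = r.toNat + v.toNat + u.toNat by omega]
  ring

/-- The part of the summand of the contiguity relation that contains `qExpMulCoeff` at
`n₁ + n₂ + n₃ - 2 N + 1`. -/
noncomputable def linRaise (α β q : K) (n₁ n₂ n₃ N : ℤ) : K :=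
  (1 - q ^ (n₁ + 1).toNat) * linTerm α β q N (n₁ + 1) n₂ n₃ -
    (1 - q ^ (n₃ + 1).toNat) * linTerm α β q N n₁ n₂ (n₃ + 1) -
    q ^ (N - n₂).toNat * (q ^ (N - n₃).toNat - q ^ (N - n₁).toNat) *
      (1 - q ^ (n₁ + n₂ + n₃ - 2 * N + 1).toNat) *
      (qPoch (α * β) q N.toNat * qExpMulCoeff α β q (n₁ + n₂ + n₃ - 2 * N + 1) *
        (qPochInv q (N - n₁) * qPochInv q (N - n₂) * qPochInv q (N - n₃)))

/-- The part of the summand of the contiguity relation that contains `qExpMulCoeff` at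
`n₁ + n₂ + n₃ - 2 N - 1`. -/
noncomputable def linLower (α β q : K) (n₁ n₂ n₃ N : ℤ) : K :=
  (1 - α * β * q ^ (n₁ - 1).toNat) * linTerm α β q N (n₁ - 1) n₂ n₃ -
    (1 - α * β * q ^ (n₃ - 1).toNat) * linTerm α β q N n₁ n₂ (n₃ - 1) +
    q ^ (N - n₂).toNat * (q ^ (N - n₃).toNat - q ^ (N - n₁).toNat) *
      (α * β * q ^ (n₁ + n₂ + n₃ - 2 * N - 1).toNat) *
      (qPoch (α * β) q N.toNat * qExpMulCoeff α β q (n₁ + n₂ + n₃ - 2 * N - 1) *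
        (qPochInv q (N - n₁) * qPochInv q (N - n₂) * qPochInv q (N - n₃)))

/-- Since $n_1=r+(N-n_2)+(N-n_3)$ for $r=n_1+n_2+n_3-2N$, and likewise for $n_3$, a factor $q^r$
splits off $q^{n_1}-q^{n_3}$; the recurrence for $e_r$ then removes $(\alpha+\beta)q^re_r$. -/
theorem linRaise_add_linLower {q : K} (hq : ∀ k : ℕ, 1 ≤ k → q ^ k ≠ 1) (α β : K)
    (n₁ n₂ n₃ N : ℤ) :
    linRaise α β q n₁ n₂ n₃ N + linLower α β q n₁ n₂ n₃ N =
      (1 - q ^ (n₁ + 1).toNat) * linTerm α β q N (n₁ + 1) n₂ n₃ -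
        (1 - q ^ (n₃ + 1).toNat) * linTerm α β q N n₁ n₂ (n₃ + 1) +
        ((1 - α * β * q ^ (n₁ - 1).toNat) * linTerm α β q N (n₁ - 1) n₂ n₃ -
          (1 - α * β * q ^ (n₃ - 1).toNat) * linTerm α β q N n₁ n₂ (n₃ - 1)) -
        (α + β) * (q ^ n₁.toNat - q ^ n₃.toNat) * linTerm α β q N n₁ n₂ n₃ := by
  have h1 := qExpMulCoeff_rec hq α β (n₁ + n₂ + n₃ - 2 * N)
  have h2 := qExpMulCoeff_mul_pow_sub (q := q) α β (n₁ + n₂ + n₃ - 2 * N)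
    (N - n₁) (N - n₂) (N - n₃)
  rw [show n₁ + n₂ + n₃ - 2 * N + (N - n₂) + (N - n₃) = n₁ by ring,
    show n₁ + n₂ + n₃ - 2 * N + (N - n₂) + (N - n₁) = n₃ by ring] at h2
  simp only [linRaise, linLower]
  rw [show linTerm α β q N n₁ n₂ n₃ = qPoch (α * β) q N.toNat *
    qExpMulCoeff α β q (n₁ + n₂ + n₃ - 2 * N) *
    (qPochInv q (N - n₁) * qPochInv q (N - n₂) * qPochInv q (N - n₃)) from rfl]
  linear_combination (α + β) * qPoch (α * β) q N.toNat * h2 +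
    q ^ (N - n₂).toNat * (q ^ (N - n₃).toNat - q ^ (N - n₁).toNat) * qPoch (α * β) q N.toNat *
      (qPochInv q (N - n₁) * qPochInv q (N - n₂) * qPochInv q (N - n₃)) * h1

theorem linRaise_add_linLower_sub_one {q : K} (hq : ∀ k : ℕ, 1 ≤ k → q ^ k ≠ 1) (α β : K)
    (n₁ n₂ n₃ N : ℤ) :
    linRaise α β q n₁ n₂ n₃ N + linLower α β q n₁ n₂ n₃ (N - 1) = 0 := by
  have h := linTerm_telescope hq α β (α * β) (n₁ + n₂ + n₃ - 2 * N + 1)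
    (N - n₁) (N - n₂) (N - n₃)
  rw [show n₁ + n₂ + n₃ - 2 * N + 1 - 1 + (N - n₁) + (N - n₂) + (N - n₃) = N by ring,
    show n₁ + n₂ + n₃ - 2 * N + 1 + (N - n₂) + (N - n₃) = n₁ + 1 by ring,
    show n₁ + n₂ + n₃ - 2 * N + 1 + (N - n₂) + (N - n₁) = n₃ + 1 by ring,
    show n₁ + n₂ + n₃ - 2 * N + 1 - 2 + (N - n₂) + (N - n₃) = n₁ - 1 by ring,
    show n₁ + n₂ + n₃ - 2 * N + 1 - 2 + (N - n₂) + (N - n₁) = n₃ - 1 by ring] at h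
  simp only [linRaise, linLower, linTerm]
  rw [show n₁ + 1 + n₂ + n₃ - 2 * N = n₁ + n₂ + n₃ - 2 * N + 1 by ring,
    show n₁ + n₂ + (n₃ + 1) - 2 * N = n₁ + n₂ + n₃ - 2 * N + 1 by ring,
    show n₁ - 1 + n₂ + n₃ - 2 * (N - 1) = n₁ + n₂ + n₃ - 2 * N + 1 by ring,
    show n₁ + n₂ + (n₃ - 1) - 2 * (N - 1) = n₁ + n₂ + n₃ - 2 * N + 1 by ring,
    show n₁ + n₂ + n₃ - 2 * (N - 1) - 1 = n₁ + n₂ + n₃ - 2 * N + 1 by ring,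
    show N - (n₁ + 1) = N - n₁ - 1 by ring, show N - (n₃ + 1) = N - n₃ - 1 by ring,
    show N - 1 - (n₁ - 1) = N - n₁ by ring, show N - 1 - (n₃ - 1) = N - n₃ by ring,
    show N - 1 - n₁ = N - n₁ - 1 by ring, show N - 1 - n₂ = N - n₂ - 1 by ring,
    show N - 1 - n₃ = N - n₃ - 1 by ring]
  linear_combination h

theorem linLower_eq_zero (α β q : K) {n₁ n₂ n₃ N : ℤ}
    (h : N < n₂ ∨ n₁ + n₂ + n₃ - 1 < 2 * N) : linLower α β q n₁ n₂ n₃ N = 0 := by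
  simp only [linLower]
  rw [linTerm_eq_zero α β q (by omega), linTerm_eq_zero α β q (by omega)]
  rcases h with h | h
  · simp [qPochInv_of_neg q (sub_neg.2 h)]
  · simp [qExpMulCoeff_of_neg α β q (show n₁ + n₂ + n₃ - 2 * N - 1 < 0 by omega)]

/-! ### Contiguity relation and the linearization coefficients -/

/-- The sum over `0 ≤ N < B` of the symmetric form of the linearization coefficients. -/
noncomputable def linSum (α β q : K) (B : ℕ) (n₁ n₂ n₃ : ℤ) : K :=
  ∑ N ∈ Finset.range B, linTerm α β q N n₁ n₂ n₃

theorem linSum_contiguous {q : K} (hq : ∀ k : ℕ, 1 ≤ k → q ^ k ≠ 1) (α β : K)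
    {B : ℕ} {n₁ n₂ n₃ : ℤ} (hn : 0 ≤ n₂) (hB : n₁ + n₂ + n₃ < B) (hB' : 0 < B) :
    (1 - q ^ (n₁ + 1).toNat) * linSum α β q B (n₁ + 1) n₂ n₃ -
        (1 - q ^ (n₃ + 1).toNat) * linSum α β q B n₁ n₂ (n₃ + 1) +
        ((1 - α * β * q ^ (n₁ - 1).toNat) * linSum α β q B (n₁ - 1) n₂ n₃ -
          (1 - α * β * q ^ (n₃ - 1).toNat) * linSum α β q B n₁ n₂ (n₃ - 1)) -
        (α + β) * (q ^ n₁.toNat - q ^ n₃.toNat) * linSum α β q B n₁ n₂ n₃ = 0 := by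
  simp only [linSum, Finset.mul_sum, ← Finset.sum_sub_distrib, ← Finset.sum_add_distrib]
  simp only [← linRaise_add_linLower hq]
  obtain ⟨B, rfl⟩ : ∃ C, B = C + 1 := ⟨B - 1, by omega⟩
  rw [Finset.sum_add_distrib, Finset.sum_range_succ (fun N : ℕ => linLower α β q n₁ n₂ n₃ N),
    linLower_eq_zero α β q (Or.inr (by omega)), Finset.sum_range_succ', add_zero,
    add_right_comm, ← Finset.sum_add_distrib]
  -- The bottom boundary term vanishes because its partner at $N=-1$ has $N<n_2$.
  have h0 := linRaise_add_linLower_sub_one hq α β n₁ n₂ n₃ 0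
  rw [linLower_eq_zero α β q (Or.inl (by omega)), add_zero] at h0
  rw [Nat.cast_zero, h0, add_zero]
  refine Finset.sum_eq_zero fun N _ => ?_
  have h := linRaise_add_linLower_sub_one hq α β n₁ n₂ n₃ (N + 1 : ℕ)
  rwa [show (((N + 1 : ℕ) : ℤ) - 1) = N by omega] at h

theorem linCoeff_eq_linSum (α β q : K) {B n₁ n₂ n₃ : ℕ} (hB : n₁ + n₂ + n₃ < B) :
    linCoeff α β q n₁ n₂ n₃ =
      (-1) ^ (n₁ + n₂ + n₃) * (qPoch q q n₁ * qPoch q q n₂ / qPoch (α * β) q n₃) *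
        linSum α β q B n₁ n₂ n₃ := by
  rw [linCoeff]
  congr 1
  have hs : linSum α β q B n₁ n₂ n₃ = ∑ N ∈ (Finset.range B).filter
      (fun N => n₁ ≤ N ∧ n₂ ≤ N ∧ n₃ ≤ N ∧ 2 * N ≤ n₁ + n₂ + n₃),
      ∑ m ∈ Finset.HasAntidiagonal.antidiagonal (n₁ + n₂ + n₃ - 2 * N),
        qPoch (α * β) q N * ((α ^ m.1 * q ^ m.1.choose 2 / qPoch q q m.1) *
          (β ^ m.2 * q ^ m.2.choose 2 / qPoch q q m.2)) *
        ((qPoch q q (N - n₁))⁻¹ * (qPoch q q (N - n₂))⁻¹ * (qPoch q q (N - n₃))⁻¹) := by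
    rw [linSum, ← Finset.sum_filter_of_ne
      (p := fun N => n₁ ≤ N ∧ n₂ ≤ N ∧ n₃ ≤ N ∧ 2 * N ≤ n₁ + n₂ + n₃)]
    · refine Finset.sum_congr rfl fun N hN => ?_
      obtain ⟨-, h1, h2, h3, h4⟩ := Finset.mem_filter.1 hN
      rw [← Finset.sum_mul, ← Finset.mul_sum, ← qExpMulCoeff_natCast, ← qPochInv_natCast,
        ← qPochInv_natCast, ← qPochInv_natCast, linTerm]
      push_cast [h1, h2, h3, h4]
      simp
    · intro N _ h
      by_contra hc
      exact h (linTerm_eq_zero α β q (by omega))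
  rw [hs, Finset.sum_sigma']
  -- The bijection is $N=n_1+m_3$, with $(m_2,M)$ on the antidiagonal of $n_1+n_2+n_3-2N$.
  refine (Finset.sum_nbij' (fun x => (x.2.1, x.1 - n₁))
    (fun m => ⟨n₁ + m.2, (m.1, n₃ + n₂ - n₁ - m.1 - 2 * m.2)⟩) ?_ ?_ ?_ ?_ ?_).symm
  · rintro ⟨N, m, M⟩ h
    simp only [Finset.mem_sigma, Finset.mem_filter, Finset.mem_range,
      Finset.HasAntidiagonal.mem_antidiagonal] at h
    simp only [mem_linIndex]
    omega
  · rintro ⟨m, k⟩ h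
    rw [mem_linIndex] at h
    simp only [Finset.mem_sigma, Finset.mem_filter, Finset.mem_range,
      Finset.HasAntidiagonal.mem_antidiagonal]
    omega
  · rintro ⟨N, m, M⟩ h
    simp only [Finset.mem_sigma, Finset.mem_filter, Finset.mem_range,
      Finset.HasAntidiagonal.mem_antidiagonal] at h
    have h1 : n₁ + (N - n₁) = N := by omega
    have h2 : n₃ + n₂ - n₁ - m - 2 * (N - n₁) = M := by omega
    simp only [h1, h2]
  · rintro ⟨m, k⟩ _
    simp
  · rintro ⟨N, m, M⟩ h
    simp only [Finset.mem_sigma, Finset.mem_filter, Finset.mem_range,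
      Finset.HasAntidiagonal.mem_antidiagonal] at h
    have h1 : n₁ + (N - n₁) = N := by omega
    have h2 : n₃ + n₂ - n₁ - m - 2 * (N - n₁) = M := by omega
    have h3 : N - n₁ + n₁ = N := by omega
    simp only [h1, h2, h3, pow_add]
    simp only [div_eq_mul_inv, mul_inv]
    ring

theorem linCoeff_eq_zero (α β q : K) {n₁ n₂ n₃ : ℕ} (h : n₁ + n₂ < n₃) :
    linCoeff α β q n₁ n₂ n₃ = 0 := by
  rw [linCoeff, Finset.sum_eq_zero, mul_zero]
  rintro ⟨m, k⟩ hm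
  rw [mem_linIndex] at hm
  omega

/-- The constraints $N\ge n_2,n_3$ and $2N\le n_2+n_3$ leave only $N=n_2=n_3$. -/
theorem linCoeff_zero_left {α β q : K} (hq : ∀ k : ℕ, 1 ≤ k → q ^ k ≠ 1)
    (hαβ : ∀ k : ℕ, α * β * q ^ k ≠ 1) (n₂ n₃ : ℕ) :
    linCoeff α β q 0 n₂ n₃ = if n₃ = n₂ then 1 else 0 := by
  rw [linCoeff_eq_linSum α β q (Nat.lt_succ_self _), linSum]
  split_ifs with h
  · subst h
    rw [Finset.sum_eq_single n₃]
    · have h1 := qPoch_ne_zero hαβ n₃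
      have h2 := qPoch_self_ne_zero hq n₃
      simp only [linTerm]
      rw [show ((0 : ℕ) : ℤ) + n₃ + n₃ - 2 * n₃ = (0 : ℕ) by ring_nf,
        show (n₃ : ℤ) - (0 : ℕ) = n₃ by simp, show (n₃ : ℤ) - n₃ = (0 : ℕ) by simp,
        qPochInv_natCast, qPochInv_natCast, qExpMulCoeff_natCast]
      simp [qPoch] at h1 h2 ⊢
      field_simp
    · intro N _ hN
      exact linTerm_eq_zero α β q (by omega)
    · intro hN
      exact absurd (Finset.mem_range.2 (by omega)) hN
  · rw [Finset.sum_eq_zero, mul_zero]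
    intro N _
    exact linTerm_eq_zero α β q (by omega)

theorem linSum_of_neg_left (α β q : K) (B : ℕ) {n₁ : ℤ} (h : n₁ < 0) (n₂ n₃ : ℤ) :
    linSum α β q B n₁ n₂ n₃ = 0 :=
  Finset.sum_eq_zero fun _ _ => linTerm_eq_zero α β q (by omega)

theorem linSum_of_neg_right (α β q : K) (B : ℕ) {n₃ : ℤ} (h : n₃ < 0) (n₁ n₂ : ℤ) :
    linSum α β q B n₁ n₂ n₃ = 0 :=
  Finset.sum_eq_zero fun _ _ => linTerm_eq_zero α β q (by omega)

theorem linCoeff_contiguous {α β q : K} (hq : ∀ k : ℕ, 1 ≤ k → q ^ k ≠ 1)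
    (hαβ : ∀ k : ℕ, α * β * q ^ k ≠ 1) (n₁ n₂ n₃ : ℕ) :
    linCoeff α β q (n₁ + 1) n₂ n₃ =
      (if n₃ = 0 then 0 else linCoeff α β q n₁ n₂ (n₃ - 1)) +
        (α + β) * q ^ n₃ * linCoeff α β q n₁ n₂ n₃ +
        (1 - q ^ (n₃ + 1)) * (1 - α * β * q ^ n₃) * linCoeff α β q n₁ n₂ (n₃ + 1) -
        (α + β) * q ^ n₁ * linCoeff α β q n₁ n₂ n₃ -
        (1 - q ^ n₁) * (1 - α * β * q ^ (n₁ - 1)) * linCoeff α β q (n₁ - 1) n₂ n₃ := by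
  set B := n₁ + n₂ + n₃ + 2
  -- Shifting $n_1$ or $n_3$ by one changes this prefactor by a sign and the factors that turn the
  -- relation for `linSum` into the one for `linCoeff`.
  set w : K := (-1) ^ (n₁ + n₂ + n₃) * (qPoch q q n₁ * qPoch q q n₂ / qPoch (α * β) q n₃) with hw
  have key := linSum_contiguous hq α β (B := B) (n₁ := n₁) (n₂ := n₂) (n₃ := n₃)
    (by omega) (by omega) (by omega)
  have ha := qPoch_ne_zero hαβ
  have hd : ∀ n : ℕ, 1 - α * β * q ^ n ≠ 0 := fun n => sub_ne_zero.2 (hαβ n).symm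
  have h0 : linCoeff α β q n₁ n₂ n₃ = w * linSum α β q B n₁ n₂ n₃ :=
    linCoeff_eq_linSum α β q (by omega)
  have h1 : linCoeff α β q (n₁ + 1) n₂ n₃ =
      -w * ((1 - q ^ (n₁ + 1)) * linSum α β q B (n₁ + 1) n₂ n₃) := by
    rw [linCoeff_eq_linSum α β q (show n₁ + 1 + n₂ + n₃ < B by omega), qPoch_succ, hw,
      Nat.cast_succ]
    ring
  have h2 : (1 - q ^ (n₃ + 1)) * (1 - α * β * q ^ n₃) * linCoeff α β q n₁ n₂ (n₃ + 1) =
      -w * ((1 - q ^ (n₃ + 1)) * linSum α β q B n₁ n₂ (n₃ + 1)) := by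
    have := ha n₃
    have := hd n₃
    rw [linCoeff_eq_linSum α β q (show n₁ + n₂ + (n₃ + 1) < B by omega), qPoch_succ, hw,
      Nat.cast_succ]
    field_simp
    ring
  have h3 : (1 - q ^ n₁) * (1 - α * β * q ^ (n₁ - 1)) * linCoeff α β q (n₁ - 1) n₂ n₃ =
      -w * ((1 - α * β * q ^ ((n₁ : ℤ) - 1).toNat) * linSum α β q B (n₁ - 1) n₂ n₃) := by
    rcases n₁ with _ | n
    · rw [linSum_of_neg_left α β q B (by simp)]
      simp
    · rw [linCoeff_eq_linSum α β q (show n + 1 - 1 + n₂ + n₃ < B by omega), hw, qPoch_succ,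
        Nat.add_sub_cancel, show (((n + 1 : ℕ) : ℤ) - 1) = n by omega, Int.toNat_natCast]
      ring
  have h4 : (if n₃ = 0 then 0 else linCoeff α β q n₁ n₂ (n₃ - 1)) =
      -w * ((1 - α * β * q ^ ((n₃ : ℤ) - 1).toNat) * linSum α β q B n₁ n₂ (n₃ - 1)) := by
    rcases n₃ with _ | n
    · rw [linSum_of_neg_right α β q B (by simp)]
      simp
    · have := ha n
      have := hd n
      rw [if_neg n.succ_ne_zero,
        linCoeff_eq_linSum α β q (show n₁ + n₂ + (n + 1 - 1) < B by omega), hw, qPoch_succ,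
        Nat.add_sub_cancel, show (((n + 1 : ℕ) : ℤ) - 1) = n by omega, Int.toNat_natCast]
      field_simp
      ring
  have e : ∀ n : ℕ, ((n : ℤ) + 1).toNat = n + 1 := fun n => by omega
  rw [e, e, Int.toNat_natCast, Int.toNat_natCast] at key
  rw [h0, h1, h2, h3, h4]
  linear_combination -w * key

/-! ### Multiplication by $2x$ and induction -/

theorem two_X_mul_alSalamChihara (α β q : K) (n : ℕ) :
    2 * Polynomial.X * alSalamChihara α β q n = alSalamChihara α β q (n + 1) +
      Polynomial.C ((α + β) * q ^ n) * alSalamChihara α β q n +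
      Polynomial.C ((1 - q ^ n) * (1 - α * β * q ^ (n - 1))) * alSalamChihara α β q (n - 1) := by
  rcases n with _ | n
  · simp [alSalamChihara]
  · rw [alSalamChihara, Nat.add_sub_cancel]
    ring

theorem two_X_mul_sum_alSalamChihara (α β q : K) (c : ℕ → K) {L : ℕ}
    (hc : ∀ n, L ≤ n → c n = 0) :
    2 * Polynomial.X * ∑ n ∈ Finset.range L, Polynomial.C (c n) * alSalamChihara α β q n =
      ∑ n ∈ Finset.range (L + 1), Polynomial.C ((if n = 0 then 0 else c (n - 1)) +
        (α + β) * q ^ n * c n + (1 - q ^ (n + 1)) * (1 - α * β * q ^ n) * c (n + 1)) *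
          alSalamChihara α β q n := by
  have h1 : ∑ n ∈ Finset.range (L + 1), Polynomial.C (if n = 0 then 0 else c (n - 1)) *
      alSalamChihara α β q n =
      ∑ n ∈ Finset.range L, Polynomial.C (c n) * alSalamChihara α β q (n + 1) := by
    rw [Finset.sum_range_succ']
    simp
  have h2 : ∑ n ∈ Finset.range (L + 1), Polynomial.C ((α + β) * q ^ n * c n) *
      alSalamChihara α β q n =
      ∑ n ∈ Finset.range L, Polynomial.C (c n) *
        (Polynomial.C ((α + β) * q ^ n) * alSalamChihara α β q n) := by
    rw [Finset.sum_range_succ, hc L le_rfl, mul_zero, map_zero, zero_mul, add_zero]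
    refine Finset.sum_congr rfl fun n _ => ?_
    rw [map_mul _ _ (c n)]
    ring
  have h3 : ∑ n ∈ Finset.range (L + 1),
      Polynomial.C ((1 - q ^ (n + 1)) * (1 - α * β * q ^ n) * c (n + 1)) *
        alSalamChihara α β q n =
      ∑ n ∈ Finset.range L, Polynomial.C (c n) *
        (Polynomial.C ((1 - q ^ n) * (1 - α * β * q ^ (n - 1))) *
          alSalamChihara α β q (n - 1)) := by
    -- Two zero terms are added at the top; the term $n=0$, which carries $1-q^0=0$, can then be
    -- dropped in the index shift.
    have h4 : ∑ n ∈ Finset.range (L + 1 + 1), Polynomial.C (c n) *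
        (Polynomial.C ((1 - q ^ n) * (1 - α * β * q ^ (n - 1))) *
          alSalamChihara α β q (n - 1)) = ∑ n ∈ Finset.range L, Polynomial.C (c n) *
        (Polynomial.C ((1 - q ^ n) * (1 - α * β * q ^ (n - 1))) *
          alSalamChihara α β q (n - 1)) := by
      rw [Finset.sum_range_succ, Finset.sum_range_succ, hc L le_rfl, hc (L + 1) L.le_succ]
      simp
    rw [← h4, Finset.sum_range_succ' _ (L + 1)]
    simp only [pow_zero, sub_self, zero_mul, map_zero, mul_zero, add_zero, Nat.add_sub_cancel]
    refine Finset.sum_congr rfl fun n _ => ?_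
    rw [map_mul _ _ (c (n + 1))]
    ring
  rw [Finset.mul_sum]
  simp only [mul_left_comm _ (Polynomial.C (c _)), two_X_mul_alSalamChihara, mul_add,
    Finset.sum_add_distrib]
  rw [← h1, ← h2, ← h3, ← Finset.sum_add_distrib, ← Finset.sum_add_distrib]
  refine Finset.sum_congr rfl fun n _ => ?_
  rw [map_add, map_add]
  ring

theorem sum_range_linCoeff_of_le (α β q : K) {n₁ n₂ L : ℕ} (h : n₁ + n₂ + 1 ≤ L) :
    ∑ n ∈ Finset.range (n₁ + n₂ + 1),
        Polynomial.C (linCoeff α β q n₁ n₂ n) * alSalamChihara α β q n =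
      ∑ n ∈ Finset.range L, Polynomial.C (linCoeff α β q n₁ n₂ n) * alSalamChihara α β q n := by
  refine Finset.sum_subset (by simpa using h) fun n _ hn => ?_
  rw [linCoeff_eq_zero α β q (by simpa using hn), map_zero, zero_mul]

theorem sum_linCoeff_succ {α β q : K} (hq : ∀ k : ℕ, 1 ≤ k → q ^ k ≠ 1)
    (hαβ : ∀ k : ℕ, α * β * q ^ k ≠ 1) (n₁ n₂ : ℕ) :
    ∑ n ∈ Finset.range (n₁ + 1 + n₂ + 1),
        Polynomial.C (linCoeff α β q (n₁ + 1) n₂ n) * alSalamChihara α β q n =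
      (2 * Polynomial.X - Polynomial.C ((α + β) * q ^ n₁)) *
        (∑ n ∈ Finset.range (n₁ + n₂ + 1),
          Polynomial.C (linCoeff α β q n₁ n₂ n) * alSalamChihara α β q n) -
      Polynomial.C ((1 - q ^ n₁) * (1 - α * β * q ^ (n₁ - 1))) *
        (∑ n ∈ Finset.range (n₁ - 1 + n₂ + 1),
          Polynomial.C (linCoeff α β q (n₁ - 1) n₂ n) * alSalamChihara α β q n) := by
  rw [sub_mul, two_X_mul_sum_alSalamChihara α β q _
      (fun n hn => linCoeff_eq_zero α β q (show n₁ + n₂ < n by omega)),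
    sum_range_linCoeff_of_le α β q (show n₁ + n₂ + 1 ≤ n₁ + n₂ + 1 + 1 by omega),
    sum_range_linCoeff_of_le α β q (show n₁ - 1 + n₂ + 1 ≤ n₁ + n₂ + 1 + 1 by omega),
    show n₁ + 1 + n₂ + 1 = n₁ + n₂ + 1 + 1 by omega, Finset.mul_sum, Finset.mul_sum,
    ← Finset.sum_sub_distrib, ← Finset.sum_sub_distrib]
  refine Finset.sum_congr rfl fun n _ => ?_
  rw [linCoeff_contiguous hq hαβ, ← mul_assoc, ← mul_assoc, ← map_mul, ← map_mul, ← sub_mul,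
    ← sub_mul, ← map_sub, ← map_sub]

theorem alSalamChihara_mul {α β q : K} (hq : ∀ k : ℕ, 1 ≤ k → q ^ k ≠ 1)
    (hαβ : ∀ k : ℕ, α * β * q ^ k ≠ 1) (n₂ n₁ : ℕ) :
    alSalamChihara α β q n₁ * alSalamChihara α β q n₂ = ∑ n ∈ Finset.range (n₁ + n₂ + 1),
      Polynomial.C (linCoeff α β q n₁ n₂ n) * alSalamChihara α β q n := by
  induction n₁ using Nat.strong_induction_on with
  | _ n₁ ih =>
    rcases n₁ with _ | n₁
    · rw [Finset.sum_eq_single n₂]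
      · simp [linCoeff_zero_left hq hαβ, alSalamChihara]
      · intro n _ hn
        simp [linCoeff_zero_left hq hαβ, hn]
      · intro h
        exact absurd (Finset.mem_range.2 (by omega)) h
    -- For `n₁ = 0` the truncated index `n₁ - 1` is harmless, as its coefficient contains $1-q^0$.
    · rw [sum_linCoeff_succ hq hαβ, ← ih n₁ (by omega), ← ih (n₁ - 1) (by omega)]
      linear_combination -alSalamChihara α β q n₂ * two_X_mul_alSalamChihara α β q n₁

end Auxiliary

theorem theorem2p1 {K : Type*} [Field K] (α β q : K)
    (hq : ∀ k : ℕ, 1 ≤ k → q ^ k ≠ 1) (hαβ : ∀ k : ℕ, α * β * q ^ k ≠ 1) (n₁ n₂ : ℕ) :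
    (∀ n₃ : ℕ, n₁ + n₂ < n₃ → linCoeff α β q n₁ n₂ n₃ = 0) ∧
      alSalamChihara α β q n₁ * alSalamChihara α β q n₂ =
        ∑ n₃ ∈ Finset.range (n₁ + n₂ + 1),
          Polynomial.C (linCoeff α β q n₁ n₂ n₃) * alSalamChihara α β q n₃ :=
  ⟨fun _ h => linCoeff_eq_zero α β q h, alSalamChihara_mul hq hαβ n₂ n₁⟩
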